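/- Consider finitely many DAG tasks $\tau_i$ and finitely many shared resources $\ell_q$. Task $\tau_i$ has a finite DAG with a unique head vertex and a unique tail vertex, worst-case execution times $c(v)\ge 0$ of its vertices, total worst-case execution time $C_i=\sum_v c(v)$, longest length $\mathcal L_i$ (sum of $c(v)$) of a path from head to tail, period $T_i$ (consecutive jobs of $\tau_i$ are released at least $T_i$ apart) and relative deadline $D_i$, $0<D_i\le T_i$. Each job of $\tau_i$ accesses $\ell_q$ at most $N_{i,q}$ times, each access lasting at most $L_{i,q}$ (access times are part of the execution times, spinning times are not). The task is scheduled by a work-conserving scheduler exclusively on $m_i\ge 1$ processors. Resources are protected by non-nested spin locks (spinning and lock holding are non-preemptive, a vertex spins only while the requested lock is held by another vertex), and requests for the same resource are served in FIFO order. Let $R_i$ be the worst-case response time of $\tau_i$, i.e. the supremum of (finish time $-$ release time) over its jobs, all jobs being assumed to finish eventually. Put \[ \eta_{i,j}^q=\begin{cases}\left\lceil (D_i+D_j)/T_j\right\rceil & \text{if } N_{i,q}>0 \text{ and } N_{j,q}>0,\\ 0&\text{otherwise,}\end{cases} \qquad \Delta_{i,q}=\min\{N_{i,q},m_i\}\Bigl(m_i-\tfrac{\min\{N_{i,q},m_i\}+1}{2}\Bigr),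 \] \[ F^I_{i,q}(x)=\bigl((N_{i,q}-x)(m_i-1)-\max\{1-x,0\}\,\Delta_{i,q}\bigr)L_{i,q}, \] \[ F^O_{i,q}(x)=\sum_{j\ne i}\min\bigl\{m_i\,\eta_{i,j}^q N_{j,q},\ (N_{i,q}+(m_i-1)x)\,m_j\bigr\}L_{j,q}, \] \[ \mathcal B_i=\frac{1}{m_i}\Bigl(C_i+(m_i-1)\mathcal L_i+\sum_{q:\,N_{i,q}>0}\ \max_{x\in\{0,1,\dots,N_{i,q}\}}\bigl(F^I_{i,q}(x)+F^O_{i,q}(x)\bigr)\Bigr). \] Suppose that either all tasks meet their deadlines ($R_j\le D_j$ for all $j$), or the bounds do ($\mathcal B_j\le D_j$ for all $j$). Then $R_i\le \mathcal B_i$ for every $i$. -/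

import Mathlib

open MeasureTheory

/-- A system of DAG tasks (indexed by `ι`) sharing resources (indexed by `ρ`) under federated
scheduling. -/
structure TaskSystem.{u, v, w} (ι : Type u) (ρ : Type v) where
  /-- vertices of the DAG of each task -/
  V : ι → Type w
  fintypeV : ∀ i, Fintype (V i)
  /-- `E i u v`: there is an edge from `u` to `v`, i.e. `u` is a predecessor of `v` -/
  E : ∀ i, V i → V i → Prop
  acyclic : ∀ i v, ¬ Relation.TransGen (E i) v v
  head : ∀ i, V i
  tail : ∀ i, V i
  /-- the head is the unique vertex without predecessors -/
  head_iff : ∀ i v, (∀ u, ¬ E i u v) ↔ v = head i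
  /-- the tail is the unique vertex without successors -/
  tail_iff : ∀ i v, (∀ u, ¬ E i v u) ↔ v = tail i
  /-- worst-case execution time of a vertex (lock holding included, spinning excluded) -/
  c : ∀ i, V i → ℝ
  c_nonneg : ∀ i v, 0 ≤ c i v
  /-- (minimal) inter-release time -/
  period : ι → ℝ
  /-- relative deadline -/
  deadline : ι → ℝ
  deadline_pos : ∀ i, 0 < deadline i
  deadline_le_period : ∀ i, deadline i ≤ period i
  /-- number of processors exclusively assigned to the task -/
  m : ι → ℕ
  m_pos : ∀ i, 0 < m i
  /-- worst-case number of accesses of a job of task `i` to resource `q` -/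
  N : ι → ρ → ℕ
  /-- worst-case duration of a single access of task `i` to resource `q` -/
  L : ι → ρ → ℝ
  L_nonneg : ∀ i q, 0 ≤ L i q

attribute [instance] TaskSystem.fintypeV

namespace TaskSystem

variable {ι : Type*} {ρ : Type*} (S : TaskSystem ι ρ)

/-- Total WCET of a task. -/
noncomputable def totalWCET (i : ι) : ℝ := ∑ v, S.c i v

/-- Complete paths: from the head to the tail along edges. -/
def IsCompletePath (i : ι) (l : List (S.V i)) : Prop :=
  l.IsChain (S.E i) ∧ l.head? = some (S.head i) ∧ l.getLast? = some (S.tail i)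

/-- Longest length of a complete path. The set is finite and non-empty, as the DAG is finite. -/
noncomputable def longestPath (i : ι) : ℝ :=
  sSup {x | ∃ l, S.IsCompletePath i l ∧ x = (l.map (S.c i)).sum}

/-- Upper bound `⌈(D_i + D_j) / T_j⌉` on the number of jobs of `j` contending with a job of `i`
on `q`; zero unless both tasks access `q`. -/
noncomputable def eta (i j : ι) (q : ρ) : ℕ :=
  if 0 < S.N i q ∧ 0 < S.N j q then ⌈(S.deadline i + S.deadline j) / S.period j⌉₊ else 0

/-- `Δ = min{N_{i,q}, m_i} (m_i - (min{N_{i,q}, m_i} + 1) / 2)`. -/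
noncomputable def Delta (i : ι) (q : ρ) : ℝ :=
  min (S.N i q : ℝ) (S.m i) * ((S.m i : ℝ) - (min (S.N i q : ℝ) (S.m i) + 1) / 2)

/-- Intra-task term `F^I(x)`. -/
noncomputable def FI (i : ι) (q : ρ) (x : ℕ) : ℝ :=
  (((S.N i q : ℝ) - x) * ((S.m i : ℝ) - 1) - max (1 - (x : ℝ)) 0 * S.Delta i q) * S.L i q

open Classical in
/-- Inter-task term `F^O(x)`. -/
noncomputable def FO [Fintype ι] (i : ι) (q : ρ) (x : ℕ) : ℝ :=
  ∑ j ∈ Finset.univ.filter (fun j => j ≠ i),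
    min ((S.m i : ℝ) * S.eta i j q * S.N j q)
      (((S.N i q : ℝ) + ((S.m i : ℝ) - 1) * x) * S.m j) * S.L j q

/-- The response time bound; the sum is over the resources accessed by task `i`. -/
noncomputable def fifoBound [Fintype ι] [Fintype ρ] (i : ι) : ℝ :=
  (S.totalWCET i + ((S.m i : ℝ) - 1) * S.longestPath i +
    ∑ q ∈ Finset.univ.filter (fun q => 0 < S.N i q),
      (Finset.range (S.N i q + 1)).sup' Finset.nonempty_range_add_one
        (fun x => S.FI i q x + S.FO i q x)) / S.m i

end TaskSystem

/-- A trace of the system. Jobs of task `i` are numbered by `k : ℕ`. Job `k` of task `i`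
issues `numReq i k` lock requests; a request is a triple `⟨i, k, n⟩`. -/
structure Schedule {ι : Type*} {ρ : Type*} (S : TaskSystem ι ρ) where
  release : ι → ℕ → ℝ
  /-- actual execution time of a vertex of a job -/
  work : ∀ i, ℕ → S.V i → ℝ
  /-- times at which a vertex of a job is executing (holding a lock or not) on a processor -/
  exec : ∀ i, ℕ → S.V i → Set ℝ
  /-- finish time of a vertex of a job -/
  finish : ∀ i, ℕ → S.V i → ℝ
  numReq : ι → ℕ → ℕ
  /-- the vertex that issues the request -/
  vertex : ∀ p : (Σ i, Σ k, Fin (numReq i k)), S.V p.1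
  /-- the requested resource -/
  res : (Σ i, Σ k, Fin (numReq i k)) → ρ
  /-- time at which the request is issued -/
  issue : (Σ i, Σ k, Fin (numReq i k)) → ℝ
  /-- time at which the lock is obtained -/
  acquire : (Σ i, Σ k, Fin (numReq i k)) → ℝ
  /-- time at which the lock is released -/
  done : (Σ i, Σ k, Fin (numReq i k)) → ℝ

namespace Schedule

variable {ι : Type*} {ρ : Type*} {S : TaskSystem ι ρ} (σ : Schedule S)

/-- Lock requests. -/
abbrev Req : Type _ := Σ i, Σ k, Fin (σ.numReq i k)

/-- The times at which a request spins. -/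
def spin (p : σ.Req) : Set ℝ := Set.Ico (σ.issue p) (σ.acquire p)

/-- The times at which a request holds the lock. -/
def hold (p : σ.Req) : Set ℝ := Set.Ico (σ.acquire p) (σ.done p)

/-- Request `p` is issued by vertex `v` of job `k` of task `i`. -/
def IssuedBy (p : σ.Req) (i : ι) (k : ℕ) (v : S.V i) : Prop :=
  ∃ n : Fin (σ.numReq i k), p = ⟨i, k, n⟩ ∧ σ.vertex ⟨i, k, n⟩ = v

/-- Vertex `v` of job `k` of task `i` is spinning at time `t`. -/
def Spinning (i : ι) (k : ℕ) (v : S.V i) (t : ℝ) : Prop :=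
  ∃ p, σ.IssuedBy p i k v ∧ t ∈ σ.spin p

/-- A processor is busy with vertex `v` of job `k` of task `i` at time `t`. -/
def Busy (i : ι) (k : ℕ) (v : S.V i) (t : ℝ) : Prop :=
  t ∈ σ.exec i k v ∨ σ.Spinning i k v t

/-- The vertex is eligible and not yet finished: its job is released and all its predecessors
are finished. -/
def Pending (i : ι) (k : ℕ) (v : S.V i) (t : ℝ) : Prop :=
  σ.release i k ≤ t ∧ (∀ u, S.E i u v → σ.finish i k u ≤ t) ∧ t < σ.finish i k v

/-- The vertices (of all jobs of task `i`) that occupy a processor at time `t`. -/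
def busySet (i : ι) (t : ℝ) : Set (ℕ × S.V i) := {a | σ.Busy i a.1 a.2 t}

/-- Schedules produced by work-conserving federated scheduling with non-nested spin locks
(with no constraint on the order in which requests are served). -/
structure IsLegal : Prop where
  release_sep : ∀ i k, σ.release i k + S.period i ≤ σ.release i (k + 1)
  work_nonneg : ∀ i k v, 0 ≤ σ.work i k v
  work_le : ∀ i k v, σ.work i k v ≤ S.c i v
  exec_measurable : ∀ i k v, MeasurableSet (σ.exec i k v)
  /-- precedence constraints -/
  pending_of_busy : ∀ i k v t, σ.Busy i k v t → σ.Pending i k v t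
  /-- the finish time is the first time at which the job is released, the predecessors are
  finished, the vertex has executed for its execution time, and its requests are completed -/
  finish_isLeast : ∀ i k v, IsLeast
    {t | σ.release i k ≤ t ∧ (∀ u, S.E i u v → σ.finish i k u ≤ t) ∧
      volume (σ.exec i k v ∩ Set.Iio t) = ENNReal.ofReal (σ.work i k v) ∧
      ∀ p, σ.IssuedBy p i k v → σ.done p ≤ t} (σ.finish i k v)
  /-- at most `m i` processors are used by task `i` -/
  capacity : ∀ i t, (σ.busySet i t).encard ≤ S.m i
  /-- no processor of task `i` idles while one of its vertices is waiting for a processor -/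
  work_conserving : ∀ i k v t, σ.Pending i k v t → ¬ σ.Busy i k v t →
    (σ.busySet i t).encard = S.m i
  issue_le_acquire : ∀ p, σ.issue p ≤ σ.acquire p
  acquire_lt_done : ∀ p, σ.acquire p < σ.done p
  /-- lock holders execute non-preemptively -/
  hold_subset_exec : ∀ i k v p, σ.IssuedBy p i k v → σ.hold p ⊆ σ.exec i k v
  /-- a spinning vertex does not execute -/
  spin_disjoint_exec : ∀ i k v p, σ.IssuedBy p i k v → Disjoint (σ.spin p) (σ.exec i k v)
  /-- locks are non-nested: a vertex completes a request before it issues another one -/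
  non_nested : ∀ i k v p p', σ.IssuedBy p i k v → σ.IssuedBy p' i k v → p ≠ p' →
    Disjoint (Set.Ico (σ.issue p) (σ.done p)) (Set.Ico (σ.issue p') (σ.done p'))
  /-- a job of task `i` accesses resource `q` at most `N i q` times -/
  access_count : ∀ i k q, {n : Fin (σ.numReq i k) | σ.res ⟨i, k, n⟩ = q}.ncard ≤ S.N i q
  /-- a single access of task `i` to resource `q` lasts at most `L i q` -/
  access_length : ∀ p : σ.Req, σ.done p - σ.acquire p ≤ S.L p.1 (σ.res p)
  mutual_exclusion : ∀ p p', p ≠ p' → σ.res p = σ.res p' → Disjoint (σ.hold p) (σ.hold p')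
  /-- a vertex spins only while the lock is held by another vertex -/
  held_of_spin : ∀ p, ∀ t ∈ σ.spin p, ∃ p', p' ≠ p ∧ σ.res p' = σ.res p ∧ t ∈ σ.hold p'

/-- Requests for the same resource are served in FIFO order (ties are broken arbitrarily). -/
def IsFIFO : Prop :=
  ∀ p p', σ.res p = σ.res p' → σ.issue p < σ.issue p' → σ.acquire p < σ.acquire p'

/-- Response time of job `k` of task `i`; the job finishes when its tail vertex does. -/
def responseTime (i : ι) (k : ℕ) : ℝ := σ.finish i k (S.tail i) - σ.release i k

/-- Worst-case response time of task `i`: the supremum over its jobs (possibly `⊤`). -/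
noncomputable def wcrt (i : ι) : EReal := ⨆ k, (σ.responseTime i k : EReal)

/-- Task `i` meets all its deadlines. -/
def Schedulable (i : ι) : Prop := σ.wcrt i ≤ (S.deadline i : EReal)

end Schedule

/-!
Fix a job. Following, from the tail backwards, a predecessor that finishes last yields a path
exactly one vertex of which is pending at any time during the job. At each time, each of the `m`
processors of the task therefore executes the job, or idles while the path executes, or is lost to
spinning: scheduling is work-conserving, so processors idle only while a vertex of the path
occupies one. Integrating gives the terms `C` and `(m - 1) 𝓛` of the bound, and it remains to
bound the time lost.

A vertex spins only while another request holds the lock, so lost time is charged to the requests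
that hold it. In FIFO order a request waits only for requests that are incomplete when it is
issued, and a task has at most one incomplete request on each of its processors. Alternatively,
the charge to another task is bounded by counting its requests, since its jobs that overlap the
given one are released within a window of length `D_i + D_j` as long as no deadline has been
missed before. If only the bounds are known to meet the deadlines, the job with the earliest
missed deadline is treated in the same way up to that deadline: then some vertex of its path is
pending, hence the job has executed for less than `C`, and the bound would exceed the deadline.
-/

theorem sum_card_filter_rel_le_sum_range_min {α β : Type*} [LinearOrder β] (s : Finset α)
    (f : α → β) (r : α → α → Prop) [DecidableRel r] (M : ℕ)
    (hr : ∀ a ∈ s, ∀ b ∈ s, r a b → f a < f b) (hM : ∀ b ∈ s, (s.filter (r · b)).card ≤ M) :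
    ∑ b ∈ s, (s.filter (r · b)).card ≤ ∑ l ∈ Finset.range s.card, min l M := by
  classical
  induction s using Finset.induction_on_max_value f with
  | empty => simp
  | insert a s ha hmax ih =>
    -- `a` maximizes `f`, hence it precedes no element, not even itself.
    have filter_insert : ∀ b ∈ insert a s, (insert a s).filter (r · b) = s.filter (r · b) := by
      intro b hb
      refine (Finset.filter_insert _ _ _).trans (if_neg fun hab => ?_)
      have hlt := hr a (s.mem_insert_self a) b hb hab
      rcases Finset.mem_insert.1 hb with rfl | hb
      exacts [lt_irrefl _ hlt, hlt.not_ge (hmax b hb)]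
    have hM' : ∀ b ∈ insert a s, (s.filter (r · b)).card ≤ M := fun b hb =>
      filter_insert b hb ▸ hM b hb
    rw [Finset.sum_congr rfl fun b hb => congrArg Finset.card (filter_insert b hb),
      Finset.sum_insert ha, Finset.card_insert_of_notMem ha, Finset.sum_range_succ, add_comm]
    refine add_le_add (ih (fun x hx y hy => ?_) fun b hb => hM' b (Finset.mem_insert_of_mem hb))
      (le_min (Finset.card_filter_le _ _) (hM' a (s.mem_insert_self a)))
    exact hr x (Finset.mem_insert_of_mem hx) y (Finset.mem_insert_of_mem hy)

theorem sum_range_min (n M : ℕ) :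
    ((∑ l ∈ Finset.range n, min l M : ℕ) : ℝ) =
      n * M - min (n : ℝ) (M + 1) * ((M + 1) - (min (n : ℝ) (M + 1) + 1) / 2) := by
  induction n with
  | zero => simp [min_eq_left (by positivity : (0 : ℝ) ≤ M + 1)]
  | succ n ih =>
    rw [Finset.sum_range_succ, Nat.cast_add, ih]
    rcases Nat.lt_or_ge M n with h | h
    · have h' : (M : ℝ) + 1 ≤ n := by exact_mod_cast h
      rw [min_eq_right h', min_eq_right h.le, min_eq_right (by push_cast; linarith)]
      push_cast
      ring
    · have h' : (n : ℝ) ≤ M := by exact_mod_cast h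
      rw [min_eq_left (by linarith), min_eq_left h, min_eq_left (by push_cast; linarith)]
      push_cast
      ring

section SeparatedSequence

variable {K : Type*} [Field K] [LinearOrder K] [IsStrictOrderedRing K] {f : ℕ → K} {T : K}

theorem add_nat_mul_le_of_add_le (hf : ∀ n, f n + T ≤ f (n + 1)) (n l : ℕ) :
    f n + l * T ≤ f (n + l) := by
  induction l with
  | zero => simp
  | succ l ih =>
    have := hf (n + l)
    rw [← add_assoc]
    push_cast
    linarith

theorem encard_preimage_Ioo_le_ceil [FloorSemiring K] (hT : 0 < T)
    (hf : ∀ n, f n + T ≤ f (n + 1)) (a b : K) :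
    (f ⁻¹' Set.Ioo a b).encard ≤ ⌈(b - a) / T⌉₊ := by
  classical
  by_cases h : ∃ n, a < f n
  · suffices f ⁻¹' Set.Ioo a b ⊆
        (Finset.Ico (Nat.find h) (Nat.find h + ⌈(b - a) / T⌉₊) : Finset ℕ) by
      simpa [-Finset.coe_Ico] using Set.encard_le_encard this
    rintro n ⟨hna, hnb⟩
    obtain ⟨l, rfl⟩ := Nat.exists_eq_add_of_le (Nat.find_min' h hna)
    have hsep := add_nat_mul_le_of_add_le hf (Nat.find h) l
    have hfirst := Nat.find_spec h
    rw [Finset.mem_coe, Finset.mem_Ico]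
    refine ⟨Nat.le_add_right _ _, Nat.add_lt_add_left (Nat.lt_ceil.2 ?_) _⟩
    rw [lt_div_iff₀ hT]
    linarith
  · have : f ⁻¹' Set.Ioo a b = ∅ := Set.eq_empty_of_forall_notMem fun n hn => h ⟨n, hn.1⟩
    simp [this]

end SeparatedSequence

theorem wellFounded_of_forall_not_transGen {α : Type*} [Finite α] {r : α → α → Prop}
    (h : ∀ a, ¬ Relation.TransGen r a a) : WellFounded r :=
  have : IsTrans α (Relation.TransGen r) := ⟨fun _ _ _ => Relation.TransGen.trans⟩
  have : Std.Irrefl (Relation.TransGen r) := ⟨h⟩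
  Subrelation.wf Relation.TransGen.single (Finite.wellFounded_of_trans_of_irrefl _)

theorem pairwise_transGen_of_isChain {α : Type*} {r : α → α → Prop} {l : List α}
    (hl : l.IsChain r) : l.Pairwise (Relation.TransGen r) :=
  have : IsTrans α (Relation.TransGen r) := ⟨fun _ _ _ => Relation.TransGen.trans⟩
  List.isChain_iff_pairwise.1 (hl.imp fun _ _ => Relation.TransGen.single)

theorem sum_indicator_one_eq_ncard {α β : Type*} (s : Finset α) (A : α → Set β) (τ : β) :
    ∑ a ∈ s, (A a).indicator (1 : β → ℝ) τ = {a | a ∈ s ∧ τ ∈ A a}.ncard := by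
  classical
  rw [← Finset.coe_filter, Set.ncard_coe_finset, Finset.card_filter, Nat.cast_sum]
  exact Finset.sum_congr rfl fun a _ => by simp [Set.indicator_apply]

namespace TaskSystem

variable {ι ρ : Type*} (S : TaskSystem ι ρ)

theorem one_le_m (i : ι) : (1 : ℝ) ≤ S.m i := Nat.one_le_cast.2 (S.m_pos i)

theorem period_pos (i : ι) : 0 < S.period i := (S.deadline_pos i).trans_le (S.deadline_le_period i)

variable {S} {i : ι}

theorem nodup_of_isChain {l : List (S.V i)} (hl : l.IsChain (S.E i)) : l.Nodup :=
  (pairwise_transGen_of_isChain hl).imp fun {u v} huv => show u ≠ v by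
    rintro rfl
    exact S.acyclic i u huv

open Classical in
theorem IsCompletePath.sum_toFinset_le_longestPath {l : List (S.V i)}
    (hl : S.IsCompletePath i l) : ∑ v ∈ l.toFinset, S.c i v ≤ S.longestPath i := by
  have length_eq : ∀ l', S.IsCompletePath i l' →
      (l'.map (S.c i)).sum = ∑ v ∈ l'.toFinset, S.c i v :=
    fun l' hl' => (List.sum_toFinset _ (nodup_of_isChain hl'.1)).symm
  rw [← length_eq l hl]
  refine le_csSup ⟨∑ v, S.c i v, ?_⟩ ⟨l, hl, rfl⟩
  rintro _ ⟨l', hl', rfl⟩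
  rw [length_eq l' hl']
  exact Finset.sum_le_univ_sum_of_nonneg (S.c_nonneg i)

variable (S) [Fintype ι] (i)

/-- The bound on the processor time that a job of task `i` loses by spinning for `q`. The variable
`x` is the number of its requests for `q` that are issued on the critical path. -/
noncomputable def maxBlocking (q : ρ) : ℝ :=
  (Finset.range (S.N i q + 1)).sup' Finset.nonempty_range_add_one
    fun x => S.FI i q x + S.FO i q x

theorem FI_add_FO_le_maxBlocking {q : ρ} {x : ℕ} (hx : x ≤ S.N i q) :
    S.FI i q x + S.FO i q x ≤ S.maxBlocking i q :=
  Finset.le_sup' (fun x => S.FI i q x + S.FO i q x)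
    (Finset.mem_range.2 (Nat.lt_succ_of_le hx))

theorem m_mul_fifoBound [Fintype ρ] :
    S.m i * S.fifoBound i = S.totalWCET i + (S.m i - 1) * S.longestPath i +
      ∑ q with 0 < S.N i q, S.maxBlocking i q :=
  mul_div_cancel₀ _ (zero_lt_one.trans_le (S.one_le_m i)).ne'

end TaskSystem

namespace Schedule

/-! ### Critical paths -/

section CriticalPath

variable {ι ρ : Type*} {S : TaskSystem ι ρ} {σ : Schedule S} {i : ι} {k : ℕ} {u v : S.V i} {τ : ℝ}

theorem IsLegal.finish_le_of_edge (hσ : σ.IsLegal) (huv : S.E i u v) :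
    σ.finish i k u ≤ σ.finish i k v :=
  (hσ.finish_isLeast i k v).1.2.1 u huv

theorem IsLegal.finish_le_of_pending (hσ : σ.IsLegal) (huv : Relation.TransGen (S.E i) u v)
    (hv : σ.Pending i k v τ) : σ.finish i k u ≤ τ := by
  induction huv using Relation.TransGen.head_induction_on with
  | single huv => exact hv.2.1 _ huv
  | head huw _ ih => exact (hσ.finish_le_of_edge huw).trans ih

theorem IsLegal.finish_le_tail (hσ : σ.IsLegal) (v : S.V i) :
    σ.finish i k v ≤ σ.finish i k (S.tail i) := by
  have wf_swap : WellFounded (Function.swap (S.E i)) :=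
    wellFounded_of_forall_not_transGen fun v hv => S.acyclic i v (Relation.transGen_swap.1 hv)
  induction v using wf_swap.induction with
  | _ v ih =>
    by_cases hv : v = S.tail i
    · rw [hv]
    · obtain ⟨w, hvw⟩ := not_forall_not.1 (mt (S.tail_iff i v).1 hv)
      exact (hσ.finish_le_of_edge hvw).trans (ih w hvw)

theorem IsLegal.release_le_finish_tail (hσ : σ.IsLegal) (i : ι) (k : ℕ) :
    σ.release i k ≤ σ.finish i k (S.tail i) :=
  (hσ.finish_isLeast i k (S.tail i)).1.1

theorem IsLegal.mem_Ico_of_pending (hσ : σ.IsLegal) (hv : σ.Pending i k v τ) :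
    τ ∈ Set.Ico (σ.release i k) (σ.finish i k (S.tail i)) :=
  ⟨hv.1, hv.2.2.trans_le (hσ.finish_le_tail v)⟩

theorem IsLegal.release_add_period_le (hσ : σ.IsLegal) {k' : ℕ} (hk : k < k') :
    σ.release i k + S.period i ≤ σ.release i k' :=
  (hσ.release_sep i k).trans <| monotone_nat_of_le_succ (f := σ.release i)
    (fun n => (le_add_of_nonneg_right (S.period_pos i).le).trans (hσ.release_sep i n)) hk

/-- The set `P` of vertices is a critical path of job `k` of task `i`: at any time during the job,
exactly one vertex of `P` is pending. -/
def IsCritical (σ : Schedule S) (i : ι) (k : ℕ) (P : Finset (S.V i)) : Prop :=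
  ∀ τ ∈ Set.Ico (σ.release i k) (σ.finish i k (S.tail i)), ∃! v, v ∈ P ∧ σ.Pending i k v τ

theorem IsCritical.eq_of_pending {P : Finset (S.V i)} (hP : σ.IsCritical i k P)
    (hσ : σ.IsLegal) (hu : u ∈ P) (hv : v ∈ P) (hpu : σ.Pending i k u τ)
    (hpv : σ.Pending i k v τ) : u = v :=
  (hP τ (hσ.mem_Ico_of_pending hpu)).unique ⟨hu, hpu⟩ ⟨hv, hpv⟩

-- The path is built backwards, through a predecessor that finishes last.
theorem exists_path_forall_exists_pending (σ : Schedule S) (i : ι) (k : ℕ) (v : S.V i) :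
    ∃ l : List (S.V i), l.IsChain (S.E i) ∧ l.head? = some (S.head i) ∧ l.getLast? = some v ∧
      ∀ τ ∈ Set.Ico (σ.release i k) (σ.finish i k v), ∃ u ∈ l, σ.Pending i k u τ := by
  induction v using (wellFounded_of_forall_not_transGen (S.acyclic i)).induction with
  | _ v ih =>
    by_cases hv : v = S.head i
    · subst hv
      refine ⟨[S.head i], by simp, by simp, by simp, fun τ hτ => ⟨_, by simp, hτ.1, ?_, hτ.2⟩⟩
      exact fun u hu => absurd hu ((S.head_iff i _).2 rfl u)
    · have : Set.Nonempty {u | S.E i u v} := not_forall_not.1 (mt (S.head_iff i v).1 hv)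
      obtain ⟨u, huv : S.E i u v, hmax⟩ :=
        Set.exists_max_image _ (σ.finish i k) (Set.toFinite _) this
      obtain ⟨l, hchain, hhead, hlast, hpending⟩ := ih u huv
      refine ⟨l ++ [v], List.isChain_append.2 ⟨hchain, by simp, ?_⟩, by simp [hhead], by simp,
        fun τ hτ => ?_⟩
      · simpa [hlast] using huv
      · rcases lt_or_ge τ (σ.finish i k u) with h | h
        · obtain ⟨w, hw, hw'⟩ := hpending τ ⟨hτ.1, h⟩
          exact ⟨w, by simp [hw], hw'⟩
        · exact ⟨v, by simp, hτ.1, fun w hw => (hmax w hw).trans h, hτ.2⟩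

theorem IsLegal.eq_of_mem_chain_of_pending (hσ : σ.IsLegal) {l : List (S.V i)}
    (hl : l.IsChain (S.E i)) (hu : u ∈ l) (hv : v ∈ l) (hpu : σ.Pending i k u τ)
    (hpv : σ.Pending i k v τ) : u = v := by
  let AtMostOnePending (x y : S.V i) : Prop :=
    σ.Pending i k x τ → σ.Pending i k y τ → x = y
  have : Std.Symm AtMostOnePending := ⟨fun _ _ h hy hx => (h hx hy).symm⟩
  have pairwise : l.Pairwise AtMostOnePending :=
    (pairwise_transGen_of_isChain hl).imp fun hxy hx hy =>
      absurd hx.2.2 (hσ.finish_le_of_pending hxy hy).not_gt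
  exact pairwise.forall_of_forall (fun _ _ _ _ => rfl) hu hv hpu hpv

theorem IsLegal.exists_isCritical (hσ : σ.IsLegal) (i : ι) (k : ℕ) :
    ∃ P : Finset (S.V i), σ.IsCritical i k P ∧ ∑ v ∈ P, S.c i v ≤ S.longestPath i := by
  classical
  obtain ⟨l, hchain, hhead, hlast, hpending⟩ :=
    σ.exists_path_forall_exists_pending i k (S.tail i)
  refine ⟨l.toFinset, fun τ hτ => ?_,
    TaskSystem.IsCompletePath.sum_toFinset_le_longestPath ⟨hchain, hhead, hlast⟩⟩
  obtain ⟨u, hu, hpu⟩ := hpending τ hτ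
  exact ⟨u, ⟨List.mem_toFinset.2 hu, hpu⟩, fun v hv =>
    hσ.eq_of_mem_chain_of_pending hchain (List.mem_toFinset.1 hv.1) hu hv.2 hpu⟩

theorem IsLegal.volume_exec_inter_le (hσ : σ.IsLegal) (W : Set ℝ) :
    volume (σ.exec i k v ∩ W) ≤ ENNReal.ofReal (σ.work i k v) := by
  rw [← (hσ.finish_isLeast i k v).1.2.2.1]
  exact measure_mono fun τ hτ =>
    ⟨hτ.1, (hσ.pending_of_busy i k v τ (Or.inl hτ.1)).2.2⟩

-- A pending vertex that has executed for its execution time holds or awaits a lock, but holding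
-- a lock amounts to executing.
theorem IsLegal.volume_exec_inter_Iio_lt (hσ : σ.IsLegal) (hv : σ.Pending i k v τ) :
    volume (σ.exec i k v ∩ Set.Iio τ) < ENNReal.ofReal (σ.work i k v) := by
  refine (hσ.volume_exec_inter_le _).lt_of_ne fun heq => ?_
  obtain ⟨p, hp, hτp⟩ : ∃ p, σ.IssuedBy p i k v ∧ τ < σ.done p := by
    by_contra! hdone
    exact ((hσ.finish_isLeast i k v).2 ⟨hv.1, hv.2.1, heq, hdone⟩).not_gt hv.2.2
  let held := Set.Ico (max (σ.acquire p) τ) (σ.done p)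
  have held_subset : held ⊆ σ.exec i k v := fun x hx =>
    hσ.hold_subset_exec i k v p hp ⟨(le_max_left _ _).trans hx.1, hx.2⟩
  have disjoint_held : Disjoint (σ.exec i k v ∩ Set.Iio τ) held :=
    Set.disjoint_left.2 fun x hx hx' => ((le_max_right _ _).trans hx'.1).not_gt hx.2
  have volume_held : 0 < volume held := by
    rw [Real.volume_Ico, ENNReal.ofReal_pos, sub_pos]
    exact max_lt (hσ.acquire_lt_done p) hτp
  have volume_union := hσ.volume_exec_inter_le (i := i) (k := k) (v := v)
    ((σ.exec i k v ∩ Set.Iio τ) ∪ held)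
  rw [Set.inter_eq_right.2 (Set.union_subset Set.inter_subset_left held_subset),
    measure_union disjoint_held measurableSet_Ico, heq] at volume_union
  exact volume_union.not_gt (ENNReal.lt_add_right ENNReal.ofReal_ne_top volume_held.ne')

theorem IsLegal.measureReal_exec_inter_le (hσ : σ.IsLegal) (W : Set ℝ) :
    volume.real (σ.exec i k v ∩ W) ≤ S.c i v :=
  (ENNReal.toReal_le_of_le_ofReal (hσ.work_nonneg i k v) (hσ.volume_exec_inter_le W)).trans
    (hσ.work_le i k v)

theorem IsLegal.measureReal_exec_inter_Ico_lt (hσ : σ.IsLegal) (hv : σ.Pending i k v τ) (r : ℝ) :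
    volume.real (σ.exec i k v ∩ Set.Ico r τ) < S.c i v := by
  have hlt : volume (σ.exec i k v ∩ Set.Ico r τ) < ENNReal.ofReal (σ.work i k v) :=
    (measure_mono (Set.inter_subset_inter_right _ Set.Ico_subset_Iio_self)).trans_lt
      (hσ.volume_exec_inter_Iio_lt hv)
  exact ((ENNReal.lt_ofReal_iff_toReal_lt hlt.ne_top).1 hlt).trans_le (hσ.work_le i k v)

end CriticalPath

/-! ### Lock requests -/

section Requests

variable {ι ρ : Type*} {S : TaskSystem ι ρ} {σ : Schedule S} {i : ι} {k : ℕ} {v : S.V i} {q : ρ}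
  {p p' : σ.Req} {τ : ℝ}

/-- The times at which a request is incomplete: it is spinning or holding the lock. -/
def span (σ : Schedule S) (p : σ.Req) : Set ℝ := Set.Ico (σ.issue p) (σ.done p)

theorem IsLegal.hold_subset_span (hσ : σ.IsLegal) (p : σ.Req) : σ.hold p ⊆ σ.span p :=
  Set.Ico_subset_Ico_left (hσ.issue_le_acquire p)

theorem IsLegal.issue_mem_span (hσ : σ.IsLegal) (p : σ.Req) : σ.issue p ∈ σ.span p :=
  ⟨le_rfl, (hσ.issue_le_acquire p).trans_lt (hσ.acquire_lt_done p)⟩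

theorem issuedBy_vertex (p : σ.Req) : σ.IssuedBy p p.1 p.2.1 (σ.vertex p) := ⟨p.2.2, rfl, rfl⟩

theorem finite_setOf_issuedBy (σ : Schedule S) (i : ι) (k : ℕ) (v : S.V i) :
    {p | σ.IssuedBy p i k v}.Finite :=
  (Set.finite_range fun n : Fin (σ.numReq i k) => (⟨i, k, n⟩ : σ.Req)).subset
    fun _ ⟨n, hp, _⟩ => ⟨n, hp.symm⟩

theorem IsLegal.busy_of_mem_span (hσ : σ.IsLegal) (hp : σ.IssuedBy p i k v)
    (hτ : τ ∈ σ.span p) : σ.Busy i k v τ := by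
  rcases lt_or_ge τ (σ.acquire p) with h | h
  · exact Or.inr ⟨p, hp, hτ.1, h⟩
  · exact Or.inl (hσ.hold_subset_exec i k v p hp ⟨h, hτ.2⟩)

theorem IsLegal.eq_of_mem_span (hσ : σ.IsLegal) (hp : σ.IssuedBy p i k v)
    (hp' : σ.IssuedBy p' i k v) (hτ : τ ∈ σ.span p) (hτ' : τ ∈ σ.span p') : p = p' := by
  by_contra hne
  exact Set.disjoint_left.1 (hσ.non_nested i k v p p' hp hp' hne) hτ hτ'

theorem IsLegal.card_le_m_of_mem_span (hσ : σ.IsLegal) {s : Finset σ.Req}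
    (hs : ∀ p ∈ s, p.1 = i ∧ τ ∈ σ.span p) : s.card ≤ S.m i := by
  have : Nonempty (ℕ × S.V i) := ⟨0, S.head i⟩
  have exists_issuer : ∀ p ∈ s, ∃ a : ℕ × S.V i, σ.IssuedBy p i a.1 a.2 := by
    rintro p hp
    obtain ⟨rfl, -⟩ := hs p hp
    exact ⟨(p.2.1, σ.vertex p), issuedBy_vertex p⟩
  choose! issuer issuedBy_issuer using exists_issuer
  have mapsTo : Set.MapsTo issuer s (σ.busySet i τ) := fun p hp =>
    hσ.busy_of_mem_span (issuedBy_issuer p hp) (hs p hp).2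
  have injOn : Set.InjOn issuer s := fun p hp p' hp' h =>
    hσ.eq_of_mem_span (issuedBy_issuer p hp) (h ▸ issuedBy_issuer p' hp') (hs p hp).2 (hs p' hp').2
  have := (Set.encard_le_encard_of_injOn mapsTo injOn).trans (hσ.capacity i τ)
  rw [Set.encard_coe_eq_coe_finsetCard] at this
  exact_mod_cast this

open Classical in
/-- The requests for the resource `q` issued by the jobs of task `i` with number in `K`. -/
noncomputable def requests (σ : Schedule S) (i : ι) (K : Finset ℕ) (q : ρ) : Finset σ.Req :=
  (K.sigma fun k => Finset.univ.filter fun n => σ.res ⟨i, k, n⟩ = q).map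
    ⟨Sigma.mk i, sigma_mk_injective⟩

theorem mem_requests {K : Finset ℕ} :
    p ∈ σ.requests i K q ↔ p.1 = i ∧ p.2.1 ∈ K ∧ σ.res p = q := by
  simp only [requests, Finset.mem_map, Finset.mem_sigma, Finset.mem_filter, Finset.mem_univ,
    true_and, Function.Embedding.coeFn_mk]
  constructor
  · rintro ⟨y, hy, rfl⟩
    exact ⟨rfl, hy⟩
  · rintro ⟨rfl, hp⟩
    exact ⟨p.2, hp, rfl⟩

theorem IssuedBy.mem_requests (hp : σ.IssuedBy p i k v) : p ∈ σ.requests i {k} (σ.res p) := by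
  obtain ⟨n, rfl, -⟩ := hp
  exact Schedule.mem_requests.2 ⟨rfl, Finset.mem_singleton_self k, rfl⟩

theorem IsLegal.card_requests_le (hσ : σ.IsLegal) (i : ι) (K : Finset ℕ) (q : ρ) :
    (σ.requests i K q).card ≤ K.card * S.N i q := by
  rw [requests, Finset.card_map, Finset.card_sigma]
  refine Finset.sum_le_card_nsmul _ _ _ fun k _ => ?_
  simpa [← Set.ncard_coe_finset] using hσ.access_count i k q

theorem IsLegal.card_requests_singleton_le (hσ : σ.IsLegal) (i : ι) (k : ℕ) (q : ρ) :
    (σ.requests i {k} q).card ≤ S.N i q := by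
  simpa using hσ.card_requests_le i {k} q

theorem IsLegal.N_pos_of_issuedBy (hσ : σ.IsLegal) (hp : σ.IssuedBy p i k v) :
    0 < S.N i (σ.res p) :=
  (Finset.card_pos.2 ⟨p, hp.mem_requests⟩).trans_le (hσ.card_requests_singleton_le i k _)

/-- Request `p` delays request `p'`: at some time `p'` spins for the lock that `p` holds. -/
def Delays (σ : Schedule S) (p p' : σ.Req) : Prop :=
  σ.res p = σ.res p' ∧ (σ.hold p ∩ σ.spin p').Nonempty

theorem Delays.acquire_lt (h : σ.Delays p p') : σ.acquire p < σ.acquire p' :=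
  have ⟨_, hhold, hspin⟩ := h.2
  hhold.1.trans_lt hspin.2

theorem Delays.issue_mem_span (h : σ.Delays p p') (hfifo : σ.IsFIFO) :
    σ.issue p' ∈ σ.span p := by
  obtain ⟨τ, hhold, hspin⟩ := h.2
  refine ⟨?_, hspin.1.trans_lt hhold.2⟩
  by_contra! hlt
  exact (hfifo p' p h.1.symm hlt).not_gt h.acquire_lt

open Classical in
theorem IsLegal.card_filter_delays_le (hσ : σ.IsLegal) (hfifo : σ.IsFIFO) {A : Finset σ.Req}
    (hA : ∀ p ∈ A, p.1 = i) (p' : σ.Req) : (A.filter (σ.Delays · p')).card ≤ S.m i :=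
  hσ.card_le_m_of_mem_span (τ := σ.issue p') fun p hp =>
    have ⟨hpA, hdelays⟩ := Finset.mem_filter.1 hp
    ⟨hA p hpA, hdelays.issue_mem_span hfifo⟩

open Classical in
theorem IsLegal.card_filter_delays_lt (hσ : σ.IsLegal) (hfifo : σ.IsFIFO) {A : Finset σ.Req}
    (hA : ∀ p ∈ A, p.1 = i) (hp' : p' ∈ A) : (A.filter (σ.Delays · p')).card < S.m i := by
  have notMem : p' ∉ A.filter (σ.Delays · p') := fun h =>
    lt_irrefl _ (Finset.mem_filter.1 h).2.acquire_lt
  -- `p'` itself occupies one of the processors of its task when it is issued.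
  rw [Nat.lt_iff_add_one_le, ← Finset.card_insert_of_notMem notMem]
  refine hσ.card_le_m_of_mem_span (τ := σ.issue p') fun p hp => ?_
  rcases Finset.mem_insert.1 hp with rfl | hp
  · exact ⟨hA p hp', hσ.issue_mem_span p⟩
  · have ⟨hpA, hdelays⟩ := Finset.mem_filter.1 hp
    exact ⟨hA p hpA, hdelays.issue_mem_span hfifo⟩

open Classical in
theorem IsLegal.sum_card_filter_delays_le (hσ : σ.IsLegal) (hfifo : σ.IsFIFO)
    {A : Finset σ.Req} (hA : ∀ p ∈ A, p.1 = i) (hcard : A.card ≤ S.N i q) :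
    ((∑ p' ∈ A, (A.filter (σ.Delays · p')).card : ℕ) : ℝ) ≤
      S.N i q * (S.m i - 1) - S.Delta i q := by
  obtain ⟨M, hM⟩ : ∃ M, S.m i = M + 1 := Nat.exists_eq_succ_of_ne_zero (S.m_pos i).ne'
  have count : ∑ p' ∈ A, (A.filter (σ.Delays · p')).card ≤
      ∑ l ∈ Finset.range (S.N i q), min l M :=
    (sum_card_filter_rel_le_sum_range_min A σ.acquire σ.Delays M (fun _ _ _ _ => Delays.acquire_lt)
      fun p' hp' => Nat.lt_succ_iff.1 ((hσ.card_filter_delays_lt hfifo hA hp').trans_eq hM)).trans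
    (Finset.sum_le_sum_of_subset (Finset.range_mono hcard))
  refine (Nat.cast_le.2 count).trans_eq ?_
  rw [sum_range_min, TaskSystem.Delta, hM]
  push_cast
  ring

/-- Vertex `v` of job `k` of task `i` is spinning for the resource `q` at time `τ`. -/
def SpinningOn (σ : Schedule S) (i : ι) (k : ℕ) (q : ρ) (v : S.V i) (τ : ℝ) : Prop :=
  ∃ p, σ.IssuedBy p i k v ∧ σ.res p = q ∧ τ ∈ σ.spin p

theorem SpinningOn.spinning (h : σ.SpinningOn i k q v τ) : σ.Spinning i k v τ :=
  have ⟨p, hp, _, hτ⟩ := h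
  ⟨p, hp, hτ⟩

theorem SpinningOn.busy (h : σ.SpinningOn i k q v τ) : σ.Busy i k v τ := Or.inr h.spinning

theorem IsLegal.notMem_exec_of_spinning (hσ : σ.IsLegal) (h : σ.Spinning i k v τ) :
    τ ∉ σ.exec i k v := by
  obtain ⟨p, hp, hτ⟩ := h
  exact Set.disjoint_left.1 (hσ.spin_disjoint_exec i k v p hp) hτ

theorem measurableSet_setOf_spinningOn (σ : Schedule S) (i : ι) (k : ℕ) (q : ρ) (v : S.V i) :
    MeasurableSet {τ | σ.SpinningOn i k q v τ} := by
  have : {τ | σ.SpinningOn i k q v τ} =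
      ⋃ p ∈ {p | σ.IssuedBy p i k v ∧ σ.res p = q}, σ.spin p := by
    ext τ
    simp only [SpinningOn, Set.mem_ofPred_eq, Set.mem_iUnion, exists_prop, and_assoc]
  rw [this]
  exact ((σ.finite_setOf_issuedBy i k v).subset fun p hp => hp.1).measurableSet_biUnion
    fun p _ => measurableSet_Ico

theorem IsLegal.measurableSet_setOf_busy (hσ : σ.IsLegal) (i : ι) (k : ℕ) (v : S.V i) :
    MeasurableSet {τ | σ.Busy i k v τ} := by
  have : {τ | σ.Busy i k v τ} =
      σ.exec i k v ∪ ⋃ p ∈ {p | σ.IssuedBy p i k v}, σ.spin p := by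
    ext τ
    simp only [Busy, Spinning, Set.mem_ofPred_eq, Set.mem_union, Set.mem_iUnion, exists_prop]
  rw [this]
  exact (hσ.exec_measurable i k v).union
    ((σ.finite_setOf_issuedBy i k v).measurableSet_biUnion fun p _ => measurableSet_Ico)

/-- The number of vertices in `P` of job `k` of task `i` that are executing at time `τ`. -/
noncomputable def execCount (σ : Schedule S) (i : ι) (k : ℕ) (P : Finset (S.V i)) (τ : ℝ) : ℝ :=
  ∑ v ∈ P, (σ.exec i k v).indicator 1 τ

/-- The number of vertices of job `k` of task `i` that are spinning for `q` at time `τ`. -/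
noncomputable def spinCount (σ : Schedule S) (i : ι) (k : ℕ) (q : ρ) (τ : ℝ) : ℝ :=
  ∑ v, {τ | σ.SpinningOn i k q v τ}.indicator 1 τ

theorem execCount_nonneg (P : Finset (S.V i)) : 0 ≤ σ.execCount i k P τ :=
  Finset.sum_nonneg fun _ _ => Set.indicator_nonneg (fun _ _ => zero_le_one) _

theorem spinCount_nonneg : 0 ≤ σ.spinCount i k q τ :=
  Finset.sum_nonneg fun _ _ => Set.indicator_nonneg (fun _ _ => zero_le_one) _

theorem one_le_execCount {P : Finset (S.V i)} (hv : v ∈ P) (hτ : τ ∈ σ.exec i k v) :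
    1 ≤ σ.execCount i k P τ :=
  calc (1 : ℝ) = (σ.exec i k v).indicator 1 τ := by simp [hτ]
    _ ≤ σ.execCount i k P τ :=
      Finset.single_le_sum (f := fun v => (σ.exec i k v).indicator (1 : ℝ → ℝ) τ)
        (fun _ _ => Set.indicator_nonneg (fun _ _ => zero_le_one) _) hv

theorem IsLegal.measurable_execCount (hσ : σ.IsLegal) (P : Finset (S.V i)) :
    Measurable (σ.execCount i k P) :=
  Finset.measurable_fun_sum _ fun v _ => measurable_one.indicator (hσ.exec_measurable i k v)

theorem measurable_spinCount : Measurable (σ.spinCount i k q) :=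
  Finset.measurable_fun_sum _ fun v _ =>
    measurable_one.indicator (σ.measurableSet_setOf_spinningOn i k q v)

theorem IsLegal.ncard_setOf_busy_le (hσ : σ.IsLegal) (i : ι) (k : ℕ) (τ : ℝ) :
    {v | σ.Busy i k v τ}.ncard ≤ S.m i := by
  have mapsTo : Set.MapsTo (Prod.mk k) {v | σ.Busy i k v τ} (σ.busySet i τ) := fun _ hv => hv
  have := (Set.encard_le_encard_of_injOn mapsTo (Prod.mk_right_injective k).injOn).trans
    (hσ.capacity i τ)
  rw [← (Set.toFinite _).cast_ncard_eq] at this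
  exact_mod_cast this

theorem IsLegal.m_le_ncard_setOf_busy (hσ : σ.IsLegal)
    (hother : ∀ k' u, σ.Busy i k' u τ → k' = k) (hv : σ.Pending i k v τ)
    (hidle : ¬ σ.Busy i k v τ) : S.m i ≤ {v | σ.Busy i k v τ}.ncard := by
  have mapsTo : Set.MapsTo Prod.snd (σ.busySet i τ) {v | σ.Busy i k v τ} := by
    rintro ⟨k', u⟩ (hu : σ.Busy i k' u τ)
    exact hother k' u hu ▸ hu
  have injOn : Set.InjOn Prod.snd (σ.busySet i τ) := fun a ha b hb h =>
    Prod.ext ((hother _ _ ha).trans (hother _ _ hb).symm) h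
  have := Set.encard_le_encard_of_injOn mapsTo injOn
  rw [hσ.work_conserving i k v τ hv hidle, ← (Set.toFinite _).cast_ncard_eq] at this
  exact_mod_cast this

theorem IsLegal.execCount_add_spinCount_le (hσ : σ.IsLegal) :
    σ.execCount i k Finset.univ τ + σ.spinCount i k q τ ≤ S.m i := by
  have disjoint : Disjoint {v | τ ∈ σ.exec i k v} {v | σ.SpinningOn i k q v τ} :=
    Set.disjoint_left.2 fun v hexec hspin => hσ.notMem_exec_of_spinning hspin.spinning hexec
  have subset_busy : {v | τ ∈ σ.exec i k v} ∪ {v | σ.SpinningOn i k q v τ} ⊆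
      {v | σ.Busy i k v τ} := Set.union_subset (fun v => Or.inl) fun v => SpinningOn.busy
  have := (Set.ncard_le_ncard subset_busy).trans (hσ.ncard_setOf_busy_le i k τ)
  rw [Set.ncard_union_eq disjoint] at this
  simp only [execCount, spinCount, sum_indicator_one_eq_ncard, Finset.mem_univ, true_and]
  exact_mod_cast this

theorem IsLegal.m_le_execCount_add_sum_spinCount [Fintype ρ] (hσ : σ.IsLegal)
    (hother : ∀ k' u, σ.Busy i k' u τ → k' = k) (hv : σ.Pending i k v τ)
    (hidle : ¬ σ.Busy i k v τ) :
    (S.m i : ℝ) ≤ σ.execCount i k Finset.univ τ +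
      ∑ q with 0 < S.N i q, σ.spinCount i k q τ := by
  have busy_subset : {v | σ.Busy i k v τ} ⊆ {v | τ ∈ σ.exec i k v} ∪
      ⋃ q ∈ Finset.univ.filter (0 < S.N i ·), {v | σ.SpinningOn i k q v τ} := by
    rintro v (hexec | ⟨p, hp, hτ⟩)
    · exact Or.inl hexec
    · exact Or.inr (Set.mem_biUnion (x := σ.res p) (by simpa using hσ.N_pos_of_issuedBy hp)
        ⟨p, hp, rfl, hτ⟩)
  have := calc S.m i ≤ {v | σ.Busy i k v τ}.ncard := hσ.m_le_ncard_setOf_busy hother hv hidle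
    _ ≤ _ := Set.ncard_le_ncard busy_subset
    _ ≤ _ := Set.ncard_union_le _ _
    _ ≤ _ := Nat.add_le_add_left (Finset.set_ncard_biUnion_le _ _) _
  simp only [execCount, spinCount, sum_indicator_one_eq_ncard, Finset.mem_univ, true_and]
  exact_mod_cast this

end Requests

/-! ### Lost capacity -/

section LostCapacity

variable {ι ρ : Type*} {S : TaskSystem ι ρ} {σ : Schedule S} {i : ι} {k : ℕ} {v : S.V i} {q : ρ}
  {P : Finset (S.V i)} {p : σ.Req} {τ : ℝ}

open Classical in
/-- The number of processors that job `k` of task `i`, with critical path `P`, loses at time `τ` by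
spinning for `q`. These are all processors that do not execute if a vertex of `P` spins for `q`, and
all processors that spin for `q` if no vertex of `P` occupies a processor. Otherwise `P` executes or
spins for another resource, and no loss is attributed to `q`. -/
noncomputable def lostCapacity (σ : Schedule S) (i : ι) (k : ℕ) (P : Finset (S.V i)) (q : ρ)
    (τ : ℝ) : ℝ :=
  if ∃ v ∈ P, σ.SpinningOn i k q v τ then S.m i - σ.execCount i k Finset.univ τ
  else if ∃ v ∈ P, σ.Busy i k v τ then 0
  else σ.spinCount i k q τ

theorem lostCapacity_of_spinningOn (hv : v ∈ P) (hspin : σ.SpinningOn i k q v τ) :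
    σ.lostCapacity i k P q τ = S.m i - σ.execCount i k Finset.univ τ :=
  if_pos ⟨v, hv, hspin⟩

theorem lostCapacity_of_not_busy (hP : ¬ ∃ v ∈ P, σ.Busy i k v τ) :
    σ.lostCapacity i k P q τ = σ.spinCount i k q τ :=
  (if_neg fun ⟨v, hv, hspin⟩ => hP ⟨v, hv, hspin.busy⟩).trans (if_neg hP)

theorem IsLegal.lostCapacity_nonneg (hσ : σ.IsLegal) : 0 ≤ σ.lostCapacity i k P q τ := by
  have hle := hσ.execCount_add_spinCount_le (i := i) (k := k) (q := q) (τ := τ)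
  have hnonneg := σ.spinCount_nonneg (i := i) (k := k) (q := q) (τ := τ)
  rw [lostCapacity]
  split_ifs <;> linarith

theorem IsLegal.lostCapacity_le_sub (hσ : σ.IsLegal) :
    σ.lostCapacity i k P q τ ≤ S.m i - σ.execCount i k Finset.univ τ := by
  have hle := hσ.execCount_add_spinCount_le (i := i) (k := k) (q := q) (τ := τ)
  have hnonneg := σ.spinCount_nonneg (i := i) (k := k) (q := q) (τ := τ)
  rw [lostCapacity]
  split_ifs <;> linarith

theorem IsLegal.lostCapacity_le (hσ : σ.IsLegal) : σ.lostCapacity i k P q τ ≤ S.m i :=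
  hσ.lostCapacity_le_sub.trans (sub_le_self _ (execCount_nonneg _))

theorem IsLegal.measurable_lostCapacity (hσ : σ.IsLegal) :
    Measurable (σ.lostCapacity i k P q) := by
  have measurableSet_exists {A : S.V i → Set ℝ} (hA : ∀ v, MeasurableSet (A v)) :
      MeasurableSet {τ | ∃ v ∈ P, τ ∈ A v} := by
    have : {τ | ∃ v ∈ P, τ ∈ A v} = ⋃ v ∈ P, A v := by ext; simp
    exact this ▸ P.measurableSet_biUnion fun v _ => hA v
  exact Measurable.ite (measurableSet_exists fun v => σ.measurableSet_setOf_spinningOn i k q v)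
    (measurable_const.sub (hσ.measurable_execCount _))
    (Measurable.ite (measurableSet_exists fun v => hσ.measurableSet_setOf_busy i k v)
      measurable_const measurable_spinCount)

theorem IsLegal.integrableOn_lostCapacity (hσ : σ.IsLegal) {W : Set ℝ} (hW : volume W ≠ ⊤) :
    IntegrableOn (σ.lostCapacity i k P q) W :=
  Measure.integrableOn_of_bounded hW hσ.measurable_lostCapacity.aestronglyMeasurable
    (M := S.m i) <| Filter.Eventually.of_forall fun τ => by
      rw [Real.norm_of_nonneg hσ.lostCapacity_nonneg]
      exact hσ.lostCapacity_le

theorem exists_spinningOn_of_lostCapacity_ne_zero (h : σ.lostCapacity i k P q τ ≠ 0) :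
    ∃ v, σ.SpinningOn i k q v τ := by
  by_contra! hspin
  refine h ((if_neg fun ⟨v, _, hv⟩ => hspin v hv).trans ?_)
  simp [spinCount, hspin]

theorem IsLegal.m_le_execCount_add_sum_lostCapacity [Fintype ρ] (hσ : σ.IsLegal)
    (hother : ∀ k' u, σ.Busy i k' u τ → k' = k) (hP : ∃ v ∈ P, σ.Pending i k v τ) :
    (S.m i : ℝ) ≤ σ.execCount i k Finset.univ τ + (S.m i - 1) * σ.execCount i k P τ +
      ∑ q with 0 < S.N i q, σ.lostCapacity i k P q τ := by
  have hm : (0 : ℝ) ≤ S.m i - 1 := sub_nonneg.2 (S.one_le_m i)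
  have path_nonneg : 0 ≤ (S.m i - 1) * σ.execCount i k P τ := mul_nonneg hm (execCount_nonneg P)
  have lost_nonneg : 0 ≤ ∑ q with 0 < S.N i q, σ.lostCapacity i k P q τ :=
    Finset.sum_nonneg fun _ _ => hσ.lostCapacity_nonneg
  by_cases hbusy : ∃ v ∈ P, σ.Busy i k v τ
  · obtain ⟨v, hv, hexec | ⟨p, hp, hτ⟩⟩ := hbusy
    · have job_executes := one_le_execCount (Finset.mem_univ v) hexec
      have path_executes := mul_le_mul_of_nonneg_left (one_le_execCount hv hexec) hm
      linarith
    · have lost_eq := lostCapacity_of_spinningOn hv ⟨p, hp, rfl, hτ⟩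
      have mem_filter : σ.res p ∈ Finset.univ.filter (0 < S.N i ·) := by
        simpa using hσ.N_pos_of_issuedBy hp
      have lost_le := Finset.single_le_sum (f := fun q => σ.lostCapacity i k P q τ)
        (fun _ _ => hσ.lostCapacity_nonneg) mem_filter
      linarith
  · obtain ⟨v, hv, hpending⟩ := hP
    have := hσ.m_le_execCount_add_sum_spinCount hother hpending fun h => hbusy ⟨v, hv, h⟩
    simp only [lostCapacity_of_not_busy hbusy]
    linarith

/-- Request `p` is issued by a vertex in `P` of job `k` of task `i`. -/
def IssuedIn (σ : Schedule S) (p : σ.Req) (i : ι) (k : ℕ) (P : Finset (S.V i)) : Prop :=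
  ∃ v ∈ P, σ.IssuedBy p i k v

theorem IsLegal.lostCapacity_eq_zero_of_mem_hold (hσ : σ.IsLegal) (hP : σ.IsCritical i k P)
    (hp : σ.IssuedIn p i k P) (hτ : τ ∈ σ.hold p) : σ.lostCapacity i k P q τ = 0 := by
  obtain ⟨v, hv, hpv⟩ := hp
  have hexec := hσ.hold_subset_exec i k v p hpv hτ
  refine (if_neg ?_).trans (if_pos ⟨v, hv, Or.inl hexec⟩)
  rintro ⟨u, hu, hspin⟩
  obtain rfl := hP.eq_of_pending hσ hu hv (hσ.pending_of_busy _ _ _ _ hspin.busy)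
    (hσ.pending_of_busy _ _ _ _ (Or.inl hexec))
  exact hσ.notMem_exec_of_spinning hspin.spinning hexec

open Classical in
/-- The number of processors that request `p` of job `k` of task `i`, with critical path `P`, can
make the job lose while it spins: spinning on the critical path may idle all the others. -/
noncomputable def weight (σ : Schedule S) (i : ι) (k : ℕ) (P : Finset (S.V i)) (p : σ.Req) : ℝ :=
  if σ.IssuedIn p i k P then S.m i else 1

theorem one_le_weight : 1 ≤ σ.weight i k P p := by
  rw [weight]
  split_ifs
  exacts [S.one_le_m i, le_rfl]

theorem spinCount_le_sum_requests :
    σ.spinCount i k q τ ≤ ∑ p ∈ σ.requests i {k} q, (σ.spin p).indicator 1 τ := by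
  classical
  simp only [spinCount, Set.indicator_apply, Set.mem_ofPred_eq, Pi.one_apply, Finset.sum_boole]
  refine Nat.cast_le.2 (Finset.card_le_card_of_forall_subsingleton
    (fun v p => σ.IssuedBy p i k v) (fun v hv => ?_) fun p _ v hv w hw => ?_)
  · obtain ⟨p, hp, rfl, hτ⟩ := (Finset.mem_filter.1 hv).2
    exact ⟨p, Finset.mem_filter.2 ⟨hp.mem_requests, hτ⟩, hp⟩
  · obtain ⟨n, rfl, hnv⟩ := hv.2
    obtain ⟨n', hn', hnw⟩ := hw.2
    obtain rfl : n = n' := by simpa using hn'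
    exact hnv.symm.trans hnw

theorem lostCapacity_le_sum_weight :
    σ.lostCapacity i k P q τ ≤
      ∑ p ∈ σ.requests i {k} q, σ.weight i k P p * (σ.spin p).indicator 1 τ := by
  have indicator_nonneg (p : σ.Req) : 0 ≤ (σ.spin p).indicator (1 : ℝ → ℝ) τ :=
    Set.indicator_nonneg (fun _ _ => zero_le_one) _
  have term_nonneg (p : σ.Req) : 0 ≤ σ.weight i k P p * (σ.spin p).indicator 1 τ :=
    mul_nonneg (zero_le_one.trans one_le_weight) (indicator_nonneg p)
  rw [lostCapacity]
  split_ifs with hspin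
  · obtain ⟨v, hv, p, hp, rfl, hτ⟩ := hspin
    calc S.m i - σ.execCount i k Finset.univ τ ≤ S.m i := sub_le_self _ (execCount_nonneg _)
      _ = σ.weight i k P p * (σ.spin p).indicator 1 τ := by
        rw [weight, if_pos ⟨v, hv, hp⟩, Set.indicator_of_mem hτ, Pi.one_apply, mul_one]
      _ ≤ _ := Finset.single_le_sum (f := fun p => σ.weight i k P p * (σ.spin p).indicator 1 τ)
        (fun p _ => term_nonneg p) hp.mem_requests
  · exact Finset.sum_nonneg fun p _ => term_nonneg p
  · exact spinCount_le_sum_requests.trans <| Finset.sum_le_sum fun p _ =>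
      le_mul_of_one_le_left (indicator_nonneg p) one_le_weight

open Classical in
/-- The requests for `q` of job `k` of task `i` that are issued by the vertices in `P`. -/
noncomputable def pathRequests (σ : Schedule S) (i : ι) (k : ℕ) (P : Finset (S.V i)) (q : ρ) :
    Finset σ.Req :=
  (σ.requests i {k} q).filter fun p => σ.IssuedIn p i k P

open Classical in
theorem IsLegal.card_pathRequests_le (hσ : σ.IsLegal) :
    (σ.pathRequests i k P q).card ≤ S.N i q :=
  (Finset.card_filter_le _ _).trans (hσ.card_requests_singleton_le i k q)

theorem IsLegal.sum_weight_le (hσ : σ.IsLegal) :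
    ∑ p ∈ σ.requests i {k} q, σ.weight i k P p ≤
      S.N i q + (S.m i - 1) * (σ.pathRequests i k P q).card := by
  classical
  calc ∑ p ∈ σ.requests i {k} q, σ.weight i k P p
      = ∑ p ∈ σ.requests i {k} q, (1 + if σ.IssuedIn p i k P then (S.m i - 1 : ℝ) else 0) :=
        Finset.sum_congr rfl fun p _ => by rw [weight]; split_ifs <;> ring
    _ = (σ.requests i {k} q).card + (S.m i - 1) * (σ.pathRequests i k P q).card := by
      rw [Finset.sum_add_distrib, Finset.sum_const, ← Finset.sum_filter, Finset.sum_const,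
        nsmul_one, nsmul_eq_mul, mul_comm (S.m i - 1 : ℝ)]
      rfl
    _ ≤ _ := by
      gcongr
      exact hσ.card_requests_singleton_le i k q

end LostCapacity

/-! ### Blocking times -/

section BlockingTime

variable {ι ρ : Type*} {S : TaskSystem ι ρ} {σ : Schedule S} {i j : ι} {k : ℕ} {q : ρ}
  {P : Finset (S.V i)} {p : σ.Req} {A : Finset σ.Req} {W : Set ℝ}

/-- The processor time that job `k` of task `i`, with critical path `P`, loses by spinning for `q`
while request `p` holds its lock. -/
noncomputable def blockingTime (σ : Schedule S) (i : ι) (k : ℕ) (P : Finset (S.V i)) (q : ρ)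
    (p : σ.Req) : ℝ :=
  ∫ τ in σ.hold p, σ.lostCapacity i k P q τ

theorem volume_hold_ne_top (p : σ.Req) : volume (σ.hold p) ≠ ⊤ := measure_Ico_lt_top.ne

theorem IsLegal.volume_real_hold_le (hσ : σ.IsLegal) (p : σ.Req) :
    volume.real (σ.hold p) ≤ S.L p.1 (σ.res p) :=
  (Real.volume_real_Ico_of_le (hσ.acquire_lt_done p).le).trans_le (hσ.access_length p)

theorem IsLegal.blockingTime_le (hσ : σ.IsLegal) {C : ℝ} (hC : 0 ≤ C)
    (hlost : ∀ τ ∈ σ.hold p, σ.lostCapacity i k P q τ ≤ C) :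
    σ.blockingTime i k P q p ≤ C * S.L p.1 (σ.res p) :=
  calc σ.blockingTime i k P q p ≤ ∫ _ in σ.hold p, C :=
        setIntegral_mono_on (hσ.integrableOn_lostCapacity (volume_hold_ne_top p))
          (integrableOn_const (volume_hold_ne_top p)) measurableSet_Ico hlost
    _ = C * volume.real (σ.hold p) := by rw [setIntegral_const, smul_eq_mul, mul_comm]
    _ ≤ C * S.L p.1 (σ.res p) := mul_le_mul_of_nonneg_left (hσ.volume_real_hold_le p) hC

theorem IsLegal.integral_lostCapacity_le_sum_blockingTime [Fintype ι] (hσ : σ.IsLegal)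
    (hW : MeasurableSet W) (hW' : volume W ≠ ⊤) {A : ι → Finset σ.Req}
    (hA : ∀ p, σ.res p = q → (σ.hold p ∩ W).Nonempty → p ∈ A p.1) :
    ∫ τ in W, σ.lostCapacity i k P q τ ≤ ∑ j, ∑ p ∈ A j, σ.blockingTime i k P q p := by
  let lostWhileHeld (p : σ.Req) : ℝ → ℝ := (σ.hold p).indicator (σ.lostCapacity i k P q)
  have integrable (p : σ.Req) : Integrable (lostWhileHeld p) :=
    (integrable_indicator_iff measurableSet_Ico).2
      (hσ.integrableOn_lostCapacity (volume_hold_ne_top p))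
  have nonneg (p : σ.Req) (τ : ℝ) : 0 ≤ lostWhileHeld p τ :=
    Set.indicator_nonneg (fun _ _ => hσ.lostCapacity_nonneg) _
  have sum_nonneg (j : ι) (τ : ℝ) : 0 ≤ ∑ p ∈ A j, lostWhileHeld p τ :=
    Finset.sum_nonneg fun p _ => nonneg p τ
  have integrable_sum : Integrable fun τ => ∑ j, ∑ p ∈ A j, lostWhileHeld p τ :=
    integrable_finsetSum _ fun j _ => integrable_finsetSum _ fun p _ => integrable p
  have lost_le : ∀ τ ∈ W, σ.lostCapacity i k P q τ ≤ ∑ j, ∑ p ∈ A j, lostWhileHeld p τ := by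
    intro τ hτ
    by_cases hzero : σ.lostCapacity i k P q τ = 0
    · exact hzero.trans_le (Finset.sum_nonneg fun j _ => sum_nonneg j τ)
    · obtain ⟨_, p', _, rfl, hspin⟩ := exists_spinningOn_of_lostCapacity_ne_zero hzero
      obtain ⟨p, -, hres, hhold⟩ := hσ.held_of_spin p' τ hspin
      calc σ.lostCapacity i k P _ τ = lostWhileHeld p τ := (Set.indicator_of_mem hhold _).symm
        _ ≤ ∑ p ∈ A p.1, lostWhileHeld p τ :=
          Finset.single_le_sum (f := (lostWhileHeld · τ)) (fun p _ => nonneg p τ)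
            (hA p hres ⟨τ, hhold, hτ⟩)
        _ ≤ _ := Finset.single_le_sum (f := fun j => ∑ p ∈ A j, lostWhileHeld p τ)
          (fun j _ => sum_nonneg j τ) (Finset.mem_univ p.1)
  calc ∫ τ in W, σ.lostCapacity i k P q τ ≤ ∫ τ in W, ∑ j, ∑ p ∈ A j, lostWhileHeld p τ :=
        setIntegral_mono_on (hσ.integrableOn_lostCapacity hW') integrable_sum.integrableOn hW
          lost_le
    _ ≤ ∫ τ, ∑ j, ∑ p ∈ A j, lostWhileHeld p τ :=
      setIntegral_le_integral integrable_sum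
        (.of_forall fun τ => Finset.sum_nonneg fun j _ => sum_nonneg j τ)
    _ = ∑ j, ∑ p ∈ A j, σ.blockingTime i k P q p := by
      rw [integral_finsetSum _ fun j _ => integrable_finsetSum _ fun p _ => integrable p]
      refine Finset.sum_congr rfl fun j _ => ?_
      rw [integral_finsetSum _ fun p _ => integrable p]
      exact Finset.sum_congr rfl fun p _ => integral_indicator measurableSet_Ico

open Classical in
theorem IsLegal.blockingTime_le_sum_delays (hσ : σ.IsLegal) (hp : σ.res p = q) :
    σ.blockingTime i k P q p ≤
      ∑ p' ∈ σ.requests i {k} q,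
        σ.weight i k P p' * if σ.Delays p p' then S.L p.1 q else 0 := by
  have integrable (p' : σ.Req) :
      IntegrableOn (fun τ => σ.weight i k P p' * (σ.spin p').indicator 1 τ) (σ.hold p) :=
    ((integrableOn_const (C := (1 : ℝ)) (volume_hold_ne_top p)).indicator
      measurableSet_Ico).const_mul _
  calc σ.blockingTime i k P q p ≤ ∫ τ in σ.hold p,
        ∑ p' ∈ σ.requests i {k} q, σ.weight i k P p' * (σ.spin p').indicator 1 τ :=
        integral_mono (hσ.integrableOn_lostCapacity (volume_hold_ne_top p))
          (integrable_finsetSum _ fun p' _ => integrable p') fun τ => lostCapacity_le_sum_weight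
    _ = ∑ p' ∈ σ.requests i {k} q, σ.weight i k P p' * volume.real (σ.hold p ∩ σ.spin p') := by
      rw [integral_finsetSum _ fun p' _ => integrable p']
      refine Finset.sum_congr rfl fun p' _ => ?_
      have measurableSet_spin : MeasurableSet (σ.spin p') := measurableSet_Ico
      rw [integral_const_mul, integral_indicator_one measurableSet_spin,
        measureReal_restrict_apply measurableSet_spin, Set.inter_comm]
    _ ≤ _ := by
      refine Finset.sum_le_sum fun p' hp' => mul_le_mul_of_nonneg_left ?_
        (zero_le_one.trans one_le_weight)
      split_ifs with hdelays
      · exact (measureReal_mono Set.inter_subset_left (volume_hold_ne_top p)).trans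
          ((hσ.volume_real_hold_le p).trans_eq (by rw [hp]))
      · have : σ.hold p ∩ σ.spin p' = ∅ := Set.not_nonempty_iff_eq_empty.1 fun hne =>
          hdelays ⟨hp.trans (mem_requests.1 hp').2.2.symm, hne⟩
        simp [this]

open Classical in
theorem IsLegal.sum_blockingTime_le_sum_delays (hσ : σ.IsLegal)
    (hA : ∀ p ∈ A, p.1 = j ∧ σ.res p = q) :
    ∑ p ∈ A, σ.blockingTime i k P q p ≤
      (∑ p' ∈ σ.requests i {k} q,
        σ.weight i k P p' * (A.filter (σ.Delays · p')).card) * S.L j q :=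
  calc ∑ p ∈ A, σ.blockingTime i k P q p
      ≤ ∑ p ∈ A, ∑ p' ∈ σ.requests i {k} q,
          σ.weight i k P p' * if σ.Delays p p' then S.L j q else 0 :=
        Finset.sum_le_sum fun p hp => by
          obtain ⟨rfl, hres⟩ := hA p hp
          exact hσ.blockingTime_le_sum_delays hres
    _ = _ := by
      rw [Finset.sum_comm, Finset.sum_mul]
      refine Finset.sum_congr rfl fun p' _ => ?_
      rw [← Finset.mul_sum, ← Finset.sum_filter, Finset.sum_const, nsmul_eq_mul, mul_assoc]

theorem IsLegal.sum_blockingTime_le_card_mul (hσ : σ.IsLegal)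
    (hA : ∀ p ∈ A, p.1 = j ∧ σ.res p = q) :
    ∑ p ∈ A, σ.blockingTime i k P q p ≤ A.card * (S.m i * S.L j q) := by
  rw [← nsmul_eq_mul]
  refine Finset.sum_le_card_nsmul _ _ _ fun p hp => ?_
  obtain ⟨rfl, rfl⟩ := hA p hp
  exact hσ.blockingTime_le (Nat.cast_nonneg _) fun _ _ => hσ.lostCapacity_le

theorem IsLegal.sum_blockingTime_le_of_isFIFO (hσ : σ.IsLegal) (hfifo : σ.IsFIFO)
    (hA : ∀ p ∈ A, p.1 = j ∧ σ.res p = q) :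
    ∑ p ∈ A, σ.blockingTime i k P q p ≤
      (S.N i q + (S.m i - 1) * (σ.pathRequests i k P q).card) * S.m j * S.L j q := by
  classical
  refine (hσ.sum_blockingTime_le_sum_delays hA).trans
    (mul_le_mul_of_nonneg_right ?_ (S.L_nonneg j q))
  calc ∑ p' ∈ σ.requests i {k} q, σ.weight i k P p' * (A.filter (σ.Delays · p')).card
      ≤ ∑ p' ∈ σ.requests i {k} q, σ.weight i k P p' * S.m j :=
        Finset.sum_le_sum fun p' _ => mul_le_mul_of_nonneg_left
          (Nat.cast_le.2 (hσ.card_filter_delays_le hfifo (fun p hp => (hA p hp).1) p'))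
          (zero_le_one.trans one_le_weight)
    _ = (∑ p' ∈ σ.requests i {k} q, σ.weight i k P p') * S.m j := (Finset.sum_mul ..).symm
    _ ≤ _ := mul_le_mul_of_nonneg_right hσ.sum_weight_le (Nat.cast_nonneg _)

theorem IsLegal.sum_blockingTime_own_le (hσ : σ.IsLegal) (hP : σ.IsCritical i k P) :
    ∑ p ∈ σ.requests i {k} q, σ.blockingTime i k P q p ≤
      (S.N i q - (σ.pathRequests i k P q).card) * (S.m i - 1) * S.L i q := by
  classical
  have hm : (0 : ℝ) ≤ S.m i - 1 := sub_nonneg.2 (S.one_le_m i)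
  have card_add_card : ((σ.pathRequests i k P q).card : ℝ) +
      ((σ.requests i {k} q).filter fun p => ¬ σ.IssuedIn p i k P).card ≤ S.N i q := by
    refine (Nat.cast_add _ _).symm.trans_le (Nat.cast_le.2 (le_trans (le_of_eq ?_)
      (hσ.card_requests_singleton_le i k q)))
    exact Finset.card_filter_add_card_filter_not (σ.IssuedIn · i k P)
  calc ∑ p ∈ σ.requests i {k} q, σ.blockingTime i k P q p
      ≤ ∑ p ∈ σ.requests i {k} q, if σ.IssuedIn p i k P then 0 else (S.m i - 1) * S.L i q := by
        refine Finset.sum_le_sum fun p hp => ?_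
        obtain ⟨rfl, hk, rfl⟩ := mem_requests.1 hp
        obtain rfl := Finset.mem_singleton.1 hk
        split_ifs with hpath
        · exact (hσ.blockingTime_le le_rfl fun τ hτ =>
            (hσ.lostCapacity_eq_zero_of_mem_hold hP hpath hτ).le).trans_eq (zero_mul _)
        · refine hσ.blockingTime_le hm fun τ hτ => hσ.lostCapacity_le_sub.trans ?_
          exact sub_le_sub_left (one_le_execCount (Finset.mem_univ _)
            (hσ.hold_subset_exec _ _ _ p (issuedBy_vertex p) hτ)) _
    _ = ((σ.requests i {k} q).filter fun p => ¬ σ.IssuedIn p i k P).card *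
          ((S.m i - 1) * S.L i q) := by
        rw [Finset.sum_ite, Finset.sum_const_zero, zero_add, Finset.sum_const, nsmul_eq_mul]
    _ ≤ _ := by
        rw [mul_assoc]
        exact mul_le_mul_of_nonneg_right (by linarith) (mul_nonneg hm (S.L_nonneg i q))

theorem IsLegal.sum_blockingTime_own_le_of_isFIFO (hσ : σ.IsLegal) (hfifo : σ.IsFIFO)
    (hpath : σ.pathRequests i k P q = ∅) :
    ∑ p ∈ σ.requests i {k} q, σ.blockingTime i k P q p ≤
      (S.N i q * (S.m i - 1) - S.Delta i q) * S.L i q := by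
  classical
  have hown : ∀ p ∈ σ.requests i {k} q, p.1 = i ∧ σ.res p = q := fun p hp =>
    ⟨(mem_requests.1 hp).1, (mem_requests.1 hp).2.2⟩
  refine (hσ.sum_blockingTime_le_sum_delays hown).trans
    (mul_le_mul_of_nonneg_right (le_trans (le_of_eq ?_) (hσ.sum_card_filter_delays_le hfifo
      (fun p hp => (hown p hp).1) (hσ.card_requests_singleton_le i k q))) (S.L_nonneg i q))
  rw [Nat.cast_sum]
  refine Finset.sum_congr rfl fun p hp => ?_
  rw [weight, if_neg (Finset.filter_eq_empty_iff.1 hpath hp), one_mul]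

theorem IsLegal.sum_blockingTime_own_le_FI (hσ : σ.IsLegal) (hfifo : σ.IsFIFO)
    (hP : σ.IsCritical i k P) :
    ∑ p ∈ σ.requests i {k} q, σ.blockingTime i k P q p ≤
      S.FI i q (σ.pathRequests i k P q).card := by
  rcases Nat.eq_zero_or_pos (σ.pathRequests i k P q).card with h | h
  · have := hσ.sum_blockingTime_own_le_of_isFIFO hfifo (Finset.card_eq_zero.1 h)
    simpa [TaskSystem.FI, h] using this
  · have one_le_card : (1 : ℝ) ≤ (σ.pathRequests i k P q).card := Nat.one_le_cast.2 h
    rw [TaskSystem.FI, max_eq_right (by linarith), zero_mul, sub_zero]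
    exact hσ.sum_blockingTime_own_le hP

theorem IsLegal.sum_blockingTime_le_min (hσ : σ.IsLegal) (hfifo : σ.IsFIFO)
    (hq : 0 < S.N i q) {K : Finset ℕ}
    (hK : K.card ≤ ⌈(S.deadline i + S.deadline j) / S.period j⌉₊) :
    ∑ p ∈ σ.requests j K q, σ.blockingTime i k P q p ≤
      min ((S.m i : ℝ) * S.eta i j q * S.N j q)
        ((S.N i q + (S.m i - 1) * (σ.pathRequests i k P q).card) * S.m j) * S.L j q := by
  have hL := S.L_nonneg j q
  have hrequests : ∀ p ∈ σ.requests j K q, p.1 = j ∧ σ.res p = q := fun p hp =>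
    ⟨(mem_requests.1 hp).1, (mem_requests.1 hp).2.2⟩
  have card_le : (σ.requests j K q).card ≤ S.eta i j q * S.N j q := by
    refine (hσ.card_requests_le j K q).trans ?_
    rcases Nat.eq_zero_or_pos (S.N j q) with h | h
    · simp [h]
    · exact Nat.mul_le_mul_right _ (hK.trans_eq (if_pos ⟨hq, h⟩).symm)
  rw [min_mul_of_nonneg _ _ hL]
  refine le_min ?_ (hσ.sum_blockingTime_le_of_isFIFO hfifo hrequests)
  calc ∑ p ∈ σ.requests j K q, σ.blockingTime i k P q p
      ≤ (σ.requests j K q).card * (S.m i * S.L j q) := hσ.sum_blockingTime_le_card_mul hrequests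
    _ ≤ (S.eta i j q * S.N j q : ℕ) * (S.m i * S.L j q) := by gcongr
    _ = S.m i * S.eta i j q * S.N j q * S.L j q := by
      push_cast
      ring

theorem IsLegal.integral_lostCapacity_le_maxBlocking [Fintype ι] (hσ : σ.IsLegal)
    (hfifo : σ.IsFIFO) (hP : σ.IsCritical i k P) (hq : 0 < S.N i q)
    (hW : MeasurableSet W) (hW' : volume W ≠ ⊤) {K : ι → Finset ℕ}
    (hK : ∀ j k' v, ∀ τ ∈ W, σ.Busy j k' v τ → k' ∈ K j) (hKi : K i = {k})
    (hKj : ∀ j ≠ i, (K j).card ≤ ⌈(S.deadline i + S.deadline j) / S.period j⌉₊) :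
    ∫ τ in W, σ.lostCapacity i k P q τ ≤ S.maxBlocking i q := by
  classical
  have mem_requests_of_hold (p : σ.Req) (hp : σ.res p = q) (h : (σ.hold p ∩ W).Nonempty) :
      p ∈ σ.requests p.1 (K p.1) q := by
    obtain ⟨τ, hhold, hτ⟩ := h
    exact mem_requests.2 ⟨rfl, hK _ _ _ τ hτ
      (hσ.busy_of_mem_span (issuedBy_vertex p) (hσ.hold_subset_span p hhold)), hp⟩
  calc ∫ τ in W, σ.lostCapacity i k P q τ
      ≤ ∑ j, ∑ p ∈ σ.requests j (K j) q, σ.blockingTime i k P q p :=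
        hσ.integral_lostCapacity_le_sum_blockingTime hW hW' mem_requests_of_hold
    _ = (∑ p ∈ σ.requests i {k} q, σ.blockingTime i k P q p) +
          ∑ j with j ≠ i, ∑ p ∈ σ.requests j (K j) q, σ.blockingTime i k P q p := by
        rw [← Finset.add_sum_erase _ _ (Finset.mem_univ i), hKi, Finset.filter_ne']
    _ ≤ S.FI i q (σ.pathRequests i k P q).card + S.FO i q (σ.pathRequests i k P q).card := by
        refine add_le_add (hσ.sum_blockingTime_own_le_FI hfifo hP) ?_
        rw [TaskSystem.FO]
        convert Finset.sum_le_sum fun j hj =>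
          hσ.sum_blockingTime_le_min hfifo hq (hKj j (Finset.mem_filter.1 hj).2)
    _ ≤ S.maxBlocking i q := S.FI_add_FO_le_maxBlocking i hσ.card_pathRequests_le

end BlockingTime

/-! ### Deadlines -/

section Deadlines

variable {ι ρ : Type*} {S : TaskSystem ι ρ} {σ : Schedule S} {i j : ι} {k k' : ℕ} {v : S.V j}
  {P : Finset (S.V i)} {r t τ : ℝ} {W : Set ℝ}

theorem IsLegal.integrableOn_indicator_exec (hσ : σ.IsLegal) (hW : volume W ≠ ⊤) :
    IntegrableOn ((σ.exec j k v).indicator (1 : ℝ → ℝ)) W :=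
  (integrableOn_const (C := (1 : ℝ)) hW).indicator (hσ.exec_measurable j k v)

theorem IsLegal.integrableOn_execCount (hσ : σ.IsLegal) (hW : volume W ≠ ⊤) :
    IntegrableOn (σ.execCount i k P) W :=
  integrable_finsetSum _ fun _ _ => hσ.integrableOn_indicator_exec hW

theorem IsLegal.integral_execCount (hσ : σ.IsLegal) (hW : volume W ≠ ⊤) :
    ∫ τ in W, σ.execCount i k P τ = ∑ v ∈ P, volume.real (σ.exec i k v ∩ W) := by
  simp only [execCount]
  rw [integral_finsetSum _ fun _ _ => hσ.integrableOn_indicator_exec hW]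
  refine Finset.sum_congr rfl fun v _ => ?_
  rw [integral_indicator_one (hσ.exec_measurable i k v),
    measureReal_restrict_apply (hσ.exec_measurable i k v)]

theorem IsLegal.m_mul_volume_le [Fintype ρ] (hσ : σ.IsLegal) (hW : MeasurableSet W)
    (hW' : volume W ≠ ⊤) (hother : ∀ τ ∈ W, ∀ k' u, σ.Busy i k' u τ → k' = k)
    (hP : ∀ τ ∈ W, ∃ v ∈ P, σ.Pending i k v τ) :
    S.m i * volume.real W ≤ ∑ v, volume.real (σ.exec i k v ∩ W) +
      (S.m i - 1) * ∑ v ∈ P, volume.real (σ.exec i k v ∩ W) +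
      ∑ q with 0 < S.N i q, ∫ τ in W, σ.lostCapacity i k P q τ := by
  have integrable_exec (P : Finset (S.V i)) : IntegrableOn (σ.execCount i k P) W :=
    hσ.integrableOn_execCount hW'
  have integrable_path := (integrable_exec P).const_mul ((S.m i : ℝ) - 1)
  have integrable_lost : IntegrableOn
      (fun τ => ∑ q with 0 < S.N i q, σ.lostCapacity i k P q τ) W :=
    integrable_finsetSum _ fun q _ => hσ.integrableOn_lostCapacity hW'
  have integral_le := setIntegral_mono_on (integrableOn_const (C := (S.m i : ℝ)) hW')
    (((integrable_exec Finset.univ).add integrable_path).add integrable_lost) hW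
    fun τ hτ => hσ.m_le_execCount_add_sum_lostCapacity (hother τ hτ) (hP τ hτ)
  rw [setIntegral_const, smul_eq_mul, mul_comm] at integral_le
  refine integral_le.trans_eq ?_
  rw [integral_add' ((integrable_exec Finset.univ).add integrable_path) integrable_lost,
    integral_add' (integrable_exec Finset.univ) integrable_path, integral_const_mul,
    hσ.integral_execCount hW', hσ.integral_execCount hW',
    integral_finsetSum _ fun q _ => hσ.integrableOn_lostCapacity hW']

/-- At time `r`, no job that is past its deadline is unfinished. -/
def NoOverdueJobAt (σ : Schedule S) (r : ℝ) : Prop :=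
  ∀ j k, σ.release j k + S.deadline j ≤ r → σ.finish j k (S.tail j) ≤ r

theorem NoOverdueJobAt.release_mem_Ioo (hr : σ.NoOverdueJobAt r) (hσ : σ.IsLegal)
    (hτ : τ ∈ Set.Ico r t) (hv : σ.Busy j k' v τ) :
    σ.release j k' ∈ Set.Ioo (r - S.deadline j) t := by
  obtain ⟨release_le, lt_finish⟩ := hσ.mem_Ico_of_pending (hσ.pending_of_busy j k' v τ hv)
  refine ⟨?_, release_le.trans_lt hτ.2⟩
  by_contra! hlt
  exact (hr j k' (le_sub_iff_add_le.1 hlt)).not_gt (hτ.1.trans_lt lt_finish)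

theorem NoOverdueJobAt.eq_of_busy (hr : σ.NoOverdueJobAt (σ.release j k)) (hσ : σ.IsLegal)
    (hτ : τ ∈ Set.Ico (σ.release j k) (σ.release j k + S.deadline j))
    (hv : σ.Busy j k' v τ) : k' = k := by
  obtain ⟨h₁, h₂⟩ := hr.release_mem_Ioo hσ hτ hv
  have deadline_le := S.deadline_le_period j
  by_contra hne
  rcases lt_or_gt_of_ne hne with h | h <;> linarith [hσ.release_add_period_le (i := j) h]

theorem NoOverdueJobAt.exists_contending_jobs (hr : σ.NoOverdueJobAt (σ.release i k))
    (hσ : σ.IsLegal) : ∃ K : ι → Finset ℕ,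
      (∀ j k' v, ∀ τ ∈ Set.Ico (σ.release i k) (σ.release i k + S.deadline i),
        σ.Busy j k' v τ → k' ∈ K j) ∧ K i = {k} ∧
      ∀ j ≠ i, (K j).card ≤ ⌈(S.deadline i + S.deadline j) / S.period j⌉₊ := by
  classical
  let released (j : ι) : Set ℕ := σ.release j ⁻¹'
    Set.Ioo (σ.release i k - S.deadline j) (σ.release i k + S.deadline i)
  have encard_released (j : ι) :
      (released j).encard ≤ ⌈(S.deadline i + S.deadline j) / S.period j⌉₊ := by
    have length_eq : σ.release i k + S.deadline i - (σ.release i k - S.deadline j) =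
        S.deadline i + S.deadline j := by ring
    exact length_eq ▸ encard_preimage_Ioo_le_ceil (S.period_pos j) (hσ.release_sep j) _ _
  have finite_released (j : ι) : (released j).Finite :=
    Set.finite_of_encard_le_coe (encard_released j)
  refine ⟨Function.update (fun j => (finite_released j).toFinset) i {k},
    fun j k' v τ hτ hv => ?_, Function.update_self .., fun j hj => ?_⟩
  · by_cases hj : j = i
    · subst hj
      rw [Function.update_self]
      exact Finset.mem_singleton.2 (hr.eq_of_busy hσ hτ hv)
    · rw [Function.update_of_ne hj]
      exact (finite_released j).mem_toFinset.2 (hr.release_mem_Ioo hσ hτ hv)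
  · rw [Function.update_of_ne hj, ← Nat.cast_le (α := ℕ∞),
      ← (finite_released j).encard_eq_coe_toFinset_card]
    exact encard_released j

theorem IsLegal.m_mul_sub_release_add_totalWCET_le [Fintype ι] [Fintype ρ] (hσ : σ.IsLegal)
    (hfifo : σ.IsFIFO) (hr : σ.NoOverdueJobAt (σ.release i k))
    (ht : t ∈ Set.Icc (σ.release i k) (σ.finish i k (S.tail i)))
    (htD : t ≤ σ.release i k + S.deadline i) :
    S.m i * (t - σ.release i k) + S.totalWCET i ≤
      ∑ v, volume.real (σ.exec i k v ∩ Set.Ico (σ.release i k) t) + S.m i * S.fifoBound i := by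
  set W := Set.Ico (σ.release i k) t
  have volume_W : volume W ≠ ⊤ := measure_Ico_lt_top.ne
  have W_subset : W ⊆ Set.Ico (σ.release i k) (σ.release i k + S.deadline i) :=
    Set.Ico_subset_Ico_right htD
  obtain ⟨P, hP, path_le⟩ := hσ.exists_isCritical i k
  obtain ⟨K, hK, hKi, hKj⟩ := hr.exists_contending_jobs hσ
  have capacity_le := hσ.m_mul_volume_le measurableSet_Ico volume_W
    (fun τ hτ _ _ => hr.eq_of_busy hσ (W_subset hτ))
    fun τ hτ => (hP τ ⟨hτ.1, hτ.2.trans_le ht.2⟩).exists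
  have path_exec_le : ∑ v ∈ P, volume.real (σ.exec i k v ∩ W) ≤ S.longestPath i :=
    (Finset.sum_le_sum fun v _ => hσ.measureReal_exec_inter_le W).trans path_le
  have lost_le : ∑ q with 0 < S.N i q, ∫ τ in W, σ.lostCapacity i k P q τ ≤
      ∑ q with 0 < S.N i q, S.maxBlocking i q := Finset.sum_le_sum fun q hq =>
    hσ.integral_lostCapacity_le_maxBlocking hfifo hP (Finset.mem_filter.1 hq).2
      measurableSet_Ico volume_W (fun j k' v τ hτ => hK j k' v τ (W_subset hτ)) hKi hKj
  have := mul_le_mul_of_nonneg_left path_exec_le (sub_nonneg.2 (S.one_le_m i))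
  rw [Real.volume_real_Ico_of_le ht.1] at capacity_le
  linarith [S.m_mul_fifoBound i]

theorem schedulable_iff :
    σ.Schedulable i ↔ ∀ k, σ.finish i k (S.tail i) ≤ σ.release i k + S.deadline i := by
  simp only [Schedulable, wcrt, iSup_le_iff, EReal.coe_le_coe_iff, responseTime,
    sub_le_iff_le_add']

theorem IsLegal.responseTime_le_fifoBound [Fintype ι] [Fintype ρ] (hσ : σ.IsLegal)
    (hfifo : σ.IsFIFO) (h : ∀ j, σ.Schedulable j) (i : ι) (k : ℕ) :
    σ.responseTime i k ≤ S.fifoBound i := by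
  have noOverdue : σ.NoOverdueJobAt (σ.release i k) := fun j k' hj =>
    (schedulable_iff.1 (h j) k').trans hj
  have active_le := hσ.m_mul_sub_release_add_totalWCET_le hfifo noOverdue
    ⟨hσ.release_le_finish_tail i k, le_rfl⟩ (schedulable_iff.1 (h i) k)
  have exec_le : ∑ v, volume.real (σ.exec i k v ∩
      Set.Ico (σ.release i k) (σ.finish i k (S.tail i))) ≤ S.totalWCET i :=
    Finset.sum_le_sum fun v _ => hσ.measureReal_exec_inter_le _
  refine le_of_mul_le_mul_left ?_ (zero_lt_one.trans_le (S.one_le_m i))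
  rw [responseTime]
  linarith

/-- Job `k` of task `i` misses its deadline. -/
def MissesDeadline (σ : Schedule S) (i : ι) (k : ℕ) : Prop :=
  σ.release i k + S.deadline i < σ.finish i k (S.tail i)

theorem IsLegal.exists_earliest_miss [Finite ι] (hσ : σ.IsLegal)
    (h : ∃ i k, σ.MissesDeadline i k) :
    ∃ i k, σ.MissesDeadline i k ∧ ∀ j k', σ.MissesDeadline j k' →
      σ.release i k + S.deadline i ≤ σ.release j k' + S.deadline j := by
  let firstMiss (j : ι) : ℕ := sInf {k | σ.MissesDeadline j k}
  obtain ⟨i, hi, hmin⟩ := Set.exists_min_image {j | ∃ k, σ.MissesDeadline j k}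
    (fun j => σ.release j (firstMiss j) + S.deadline j) (Set.toFinite _) h
  refine ⟨i, firstMiss i, Nat.sInf_mem hi, fun j k' hj => (hmin j ⟨k', hj⟩).trans ?_⟩
  rcases (show firstMiss j ≤ k' from Nat.sInf_le hj).eq_or_lt with heq | hlt
  · rw [heq]
  · linarith [hσ.release_add_period_le (i := j) hlt, S.period_pos j]

theorem MissesDeadline.exec_lt_totalWCET (h : σ.MissesDeadline i k) (hσ : σ.IsLegal) :
    ∑ v, volume.real (σ.exec i k v ∩
      Set.Ico (σ.release i k) (σ.release i k + S.deadline i)) < S.totalWCET i := by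
  obtain ⟨P, hP, -⟩ := hσ.exists_isCritical i k
  obtain ⟨v, -, hv⟩ := (hP _ ⟨le_add_of_nonneg_right (S.deadline_pos i).le, h⟩).exists
  exact Finset.sum_lt_sum (fun v _ => hσ.measureReal_exec_inter_le _)
    ⟨v, Finset.mem_univ v, hσ.measureReal_exec_inter_Ico_lt hv _⟩

theorem IsLegal.schedulable_of_fifoBound_le [Fintype ι] [Fintype ρ] (hσ : σ.IsLegal)
    (hfifo : σ.IsFIFO) (h : ∀ j, S.fifoBound j ≤ S.deadline j) (i : ι) : σ.Schedulable i := by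
  refine schedulable_iff.2 fun k => ?_
  by_contra! hmiss
  obtain ⟨i, k, hmiss, hearliest⟩ := hσ.exists_earliest_miss ⟨i, k, hmiss⟩
  have deadline_pos := S.deadline_pos i
  have noOverdue : σ.NoOverdueJobAt (σ.release i k) := fun j k' hj => by
    by_contra! hfinish
    linarith [hearliest j k' (hj.trans_lt hfinish)]
  have active_le := hσ.m_mul_sub_release_add_totalWCET_le hfifo noOverdue
    ⟨le_add_of_nonneg_right deadline_pos.le, hmiss.le⟩ le_rfl
  have bound_le := mul_le_mul_of_nonneg_left (h i) (zero_le_one.trans (S.one_le_m i))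
  rw [add_sub_cancel_left] at active_le
  linarith [hmiss.exec_lt_totalWCET hσ]

end Deadlines

end Schedule

theorem mainTheorem3 {ι : Type*} {ρ : Type*} [Fintype ι] [Fintype ρ] (S : TaskSystem ι ρ)
    (σ : Schedule S) (hσ : σ.IsLegal) (hfifo : σ.IsFIFO)
    (h : (∀ j, σ.Schedulable j) ∨ (∀ j, S.fifoBound j ≤ S.deadline j)) (i : ι) :
    σ.wcrt i ≤ (S.fifoBound i : EReal) := by
  have hs : ∀ j, σ.Schedulable j := h.elim id (hσ.schedulable_of_fifoBound_le hfifo)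
  exact iSup_le fun k => EReal.coe_le_coe_iff.2 (hσ.responseTime_le_fifoBound hfifo hs i k)
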